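/- A $\mathbb{Z}^2$-topological dynamical system $(X,T)$ is a compact metric space $X$ with an action $g\mapsto T^{g}$ of $\mathbb{Z}^2$ on $X$ by homeomorphisms; $M(X,T)$ is the set of $T$-invariant Borel probability measures on $X$, and $\mathcal{B}_X$ is the Borel $\sigma$-algebra of $X$. Fix a direction $\vec v=(1,\beta)$ with $\beta\in\mathbb{R}$. For $b>0$ put $$\Lambda^{\vec v}(b)=\{(m,n)\in\mathbb{Z}^2:\ \beta m-b/2\le n\le \beta m+b/2\}.$$ For a probability measure $\mu$ invariant under a $\mathbb{Z}^2$-action $T$ on $(X,\mathcal{B})$, let $$\mathcal{K}^{\vec v}_\mu(b)=\left\{B\in\mathcal{B}:\ \overline{\{1_B\circ T^{(m,n)}:(m,n)\in\Lambda^{\vec v}(b)\}}\ \text{is compact in } L^2(X,\mathcal{B},\mu)\right\}$$ be the $\vec v$-directional Kronecker algebra computed with the width $b$. The system $(X,\mathcal{B},\mu,T)$ is called $\vec v$-weak mixing (with respect to $b$) if $\mathcal{K}^{\vec v}_\mu(b)=\{X,\emptyset\}$ modulo $\mu$-null sets, that is, every $B\in\mathcal{K}^{\vec v}_\mu(b)$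 satisfies $\mu(B)\in\{0,1\}$. **Theorem.** Let $(X_1,T_1)$ and $(X_2,T_2)$ be two $\mathbb{Z}^2$-topological dynamical systems, let $\mu\in M(X_1,T_1)$, $\nu\in M(X_2,T_2)$, and let $\vec v=(1,\beta)\in\mathbb{R}^2$. If $(X_1,\mathcal{B}_{X_1},\mu,T_1)$ and $(X_2,\mathcal{B}_{X_2},\nu,T_2)$ are $\vec v$-weak mixing, then so is the product system $(X_1\times X_2,\mathcal{B}_{X_1}\times\mathcal{B}_{X_2},\mu\times\nu,T_1\times T_2)$, where $(T_1\times T_2)^{g}=T_1^{g}\times T_2^{g}$ for $g\in\mathbb{Z}^2$. This holds for every choice of the widths: if $\mathcal{K}^{\vec v}_\mu(b_1)$ and $\mathcal{K}^{\vec v}_\nu(b_2)$ are trivial modulo null sets for some $b_1,b_2>0$, then $\mathcal{K}^{\vec v}_{\mu\times\nu}(b)$ is trivial modulo null sets for every $b>0$. -/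

import Mathlib

open MeasureTheory

namespace DirectionalMixing

/-- The strip `Λ(b)` of width `b` in `ℤ²` around the line spanned by `(1, β)`. -/
def strip (β b : ℝ) : Set (ℤ × ℤ) :=
  {p | β * (p.1 : ℝ) - b / 2 ≤ (p.2 : ℝ) ∧ (p.2 : ℝ) ≤ β * (p.1 : ℝ) + b / 2}

section Systems

variable {X : Type*} [MeasurableSpace X] [AddAction (ℤ × ℤ) X] [MeasurableConstVAdd (ℤ × ℤ) X]

/-- The Koopman operator `f ↦ f ∘ T^g` on the complex space `L²(μ)`, where `T^g x = g +ᵥ x`. -/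
noncomputable def koopman (μ : Measure X) [VAddInvariantMeasure (ℤ × ℤ) X μ] (g : ℤ × ℤ) :
    Lp ℂ 2 μ →ₗᵢ[ℂ] Lp ℂ 2 μ :=
  Lp.compMeasurePreservingₗᵢ ℂ (fun x : X => g +ᵥ x) (measurePreserving_vadd g μ)

/-- The directional Kronecker algebra in direction `(1, β)`, computed with the strip of width `b`:
the measurable sets `B` such that the orbit of `1_B` along the strip has compact closure in `L²`. -/
def kroneckerAlgebra (μ : Measure X) [IsProbabilityMeasure μ]
    [VAddInvariantMeasure (ℤ × ℤ) X μ] (β b : ℝ) : Set (Set X) :=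
  {B | ∃ hB : MeasurableSet B,
    IsCompact (closure ((fun g : ℤ × ℤ =>
      koopman μ g (indicatorConstLp 2 hB (measure_ne_top μ B) (1 : ℂ))) '' strip β b))}

/-- The system is weakly mixing in direction `(1, β)` (with the strip of width `b`): its directional
Kronecker algebra consists, up to null sets, of the empty set and the whole space only. -/
def IsWeakMixing (μ : Measure X) [IsProbabilityMeasure μ]
    [VAddInvariantMeasure (ℤ × ℤ) X μ] (β b : ℝ) : Prop :=
  ∀ B ∈ kroneckerAlgebra μ β b, B =ᵐ[μ] (∅ : Set X) ∨ B =ᵐ[μ] (Set.univ : Set X)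

end Systems

section Product

variable {X Y : Type*} [MeasurableSpace X] [AddAction (ℤ × ℤ) X] [MeasurableConstVAdd (ℤ × ℤ) X]
  [MeasurableSpace Y] [AddAction (ℤ × ℤ) Y] [MeasurableConstVAdd (ℤ × ℤ) Y]

/-- The product action `g +ᵥ (x, y) = (g +ᵥ x, g +ᵥ y)` is measurable. -/
instance instMeasurableConstVAddProd : MeasurableConstVAdd (ℤ × ℤ) (X × Y) where
  measurable_const_vadd g :=
    ((measurable_const_vadd g).comp measurable_fst).prodMk
      ((measurable_const_vadd g).comp measurable_snd)

/-- The product measure is invariant under the product action. -/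
instance instVAddInvariantMeasureProd (μ : Measure X) (ν : Measure Y)
    [IsProbabilityMeasure μ] [IsProbabilityMeasure ν]
    [VAddInvariantMeasure (ℤ × ℤ) X μ] [VAddInvariantMeasure (ℤ × ℤ) Y ν] :
    VAddInvariantMeasure (ℤ × ℤ) (X × Y) (μ.prod ν) where
  measure_preimage_vadd g _ hs :=
    ((measurePreserving_vadd g μ).prod (measurePreserving_vadd g ν)).measure_preimage
      hs.nullMeasurableSet

end Product

end DirectionalMixing

namespace DirectionalMixing

open scoped ENNReal symmDiff

/-! Let `B` lie in the Kronecker algebra of the product. For measurable `C ⊆ Y` put `f_C(x) = ν(B_x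
∩ C)`. Invariance of `ν` gives `f_C(g +ᵥ x) = ν((T g)_x ∩ W g)`, where `T g`, `W g` are the
preimages of `B`, `C` under `g`. Along the strip, `T g` stays close to finitely many sets `T k`. For
a fixed `T k`, the integral operator with kernel `1_{T k}` is compact, so the functions `x ↦ ν((T
k)_x ∩ W)` are totally bounded over all `W` (`finitelyColorable_fiberMass`). Hence `f_C` is almost
periodic (`AlmostPeriodic.fiberMass`). Its superlevel sets then lie in the Kronecker algebra of `μ`,
so weak mixing makes `f_C` a.e. constant.

Thus `B` is independent of the first factor (`IsWeakMixing.prod_inter_prod`), and by symmetry of the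
second. It is therefore independent of every rectangle, hence of itself: its measure `m` satisfies
`m = m²`. -/

/-- The index set `S` splits into finitely many classes such that any two members of a class are
related by `r`. -/
def FinitelyColorable {ι : Type*} (S : Set ι) (r : ι → ι → Prop) : Prop :=
  ∃ (n : ℕ) (c : ι → Fin n), ∀ g ∈ S, ∀ h ∈ S, c g = c h → r g h

/-! ### Finite colorings, a form of total boundedness that combines easily. -/

namespace FinitelyColorable

variable {ι : Type*} {S : Set ι} {r s : ι → ι → Prop}

theorem of_finite {κ : Type*} [Finite κ] (c : ι → κ)
    (h : ∀ g ∈ S, ∀ h ∈ S, c g = c h → r g h) : FinitelyColorable S r := by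
  obtain ⟨n, ⟨e⟩⟩ := Finite.exists_equiv_fin κ
  exact ⟨n, fun g => e (c g), fun g hg k hk hgk => h g hg k hk (e.injective hgk)⟩

theorem mono (h : FinitelyColorable S r) (hrs : ∀ g ∈ S, ∀ h ∈ S, r g h → s g h) :
    FinitelyColorable S s := by
  obtain ⟨n, c, hc⟩ := h
  exact ⟨n, c, fun g hg k hk hgk => hrs g hg k hk (hc g hg k hk hgk)⟩

theorem and (hr : FinitelyColorable S r) (hs : FinitelyColorable S s) :
    FinitelyColorable S (fun g h => r g h ∧ s g h) := by
  obtain ⟨n, c, hc⟩ := hr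
  obtain ⟨m, d, hd⟩ := hs
  refine of_finite (fun g => (c g, d g)) fun g hg k hk hgk => ?_
  rw [Prod.mk.injEq] at hgk
  exact ⟨hc g hg k hk hgk.1, hd g hg k hk hgk.2⟩

theorem forall_finite {κ : Type*} [Finite κ] {R : κ → ι → ι → Prop}
    (h : ∀ i, FinitelyColorable S (R i)) : FinitelyColorable S (fun g h => ∀ i, R i g h) := by
  choose m c hc using h
  exact of_finite (fun g i => c i g) fun g hg k hk hgk i => hc i g hg k hk (congrFun hgk i)

/-- If `S` is colored, each color class has a representative. -/
theorem exists_representative (h : FinitelyColorable S r) :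
    ∃ t : Set ι, t.Finite ∧ t ⊆ S ∧ ∀ g ∈ S, ∃ k ∈ t, r g k := by
  classical
  obtain ⟨n, c, hc⟩ := h
  have : ∀ i : Fin n, ∃ t : Set ι, t.Finite ∧ t ⊆ S ∧ ∀ g ∈ S, c g = i → ∃ k ∈ t, r g k := by
    intro i
    by_cases hi : ∃ k ∈ S, c k = i
    · obtain ⟨k, hk, hki⟩ := hi
      exact ⟨{k}, Set.finite_singleton k, by simpa using hk,
        fun g hg hgi => ⟨k, rfl, hc g hg k hk (hgi.trans hki.symm)⟩⟩
    · exact ⟨∅, Set.finite_empty, Set.empty_subset _, fun g hg hgi => (hi ⟨g, hg, hgi⟩).elim⟩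
  choose t ht htS htr using this
  refine ⟨⋃ i, t i, Set.finite_iUnion ht, Set.iUnion_subset htS, fun g hg => ?_⟩
  obtain ⟨k, hk, hgk⟩ := htr (c g) g hg rfl
  exact ⟨k, Set.mem_iUnion.2 ⟨_, hk⟩, hgk⟩

/-- The color of `g` is a chosen centre `k`; `hq` plays the role of the triangle inequality through
that centre. -/
theorem of_representative {κ : Type*} {t : Set κ} (ht : t.Finite) {q : ι → κ → Prop}
    (h : ∀ g ∈ S, ∃ k ∈ t, q g k) (hq : ∀ g ∈ S, ∀ h ∈ S, ∀ k, q g k → q h k → r g h) :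
    FinitelyColorable S r := by
  classical
  have := ht.to_subtype
  rcases S.eq_empty_or_nonempty with rfl | ⟨g₀, hg₀⟩
  · exact ⟨1, fun _ => 0, by simp⟩
  obtain ⟨k₀, hk₀, -⟩ := h g₀ hg₀
  have : ∀ g, ∃ k : t, g ∈ S → q g k := by
    intro g
    by_cases hg : g ∈ S
    · obtain ⟨k, hk, hgk⟩ := h g hg
      exact ⟨⟨k, hk⟩, fun _ => hgk⟩
    · exact ⟨⟨k₀, hk₀⟩, fun h' => (hg h').elim⟩
  choose c hc using this
  refine of_finite c fun g hg k hk hgk => hq g hg k hk (c g) (hc g hg) ?_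
  rw [hgk]
  exact hc k hk

end FinitelyColorable

theorem FinitelyColorable.of_totallyBounded {ι α : Type*} [PseudoMetricSpace α] {S : Set ι}
    {f : ι → α} (h : TotallyBounded (f '' S)) {ε : ℝ} (hε : 0 < ε) :
    FinitelyColorable S (fun g h => dist (f g) (f h) ≤ ε) := by
  obtain ⟨t, ht, hcov⟩ := Metric.totallyBounded_iff.1 h (ε / 2) (half_pos hε)
  refine of_representative ht (q := fun g y => dist (f g) y < ε / 2) (fun g hg => ?_)
    fun g _ k _ y hg hk => ?_
  · obtain ⟨y, hy, hgy⟩ := Set.mem_iUnion₂.1 (hcov ⟨g, hg, rfl⟩)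
    exact ⟨y, hy, hgy⟩
  · linarith [dist_triangle_right (f g) (f k) y]

/-- A bounded real function takes nearby values on the classes of a finite coloring. -/
theorem FinitelyColorable.of_real_bounded {ι : Type*} {S : Set ι} (f : ι → ℝ) {a b : ℝ}
    (hf : ∀ g ∈ S, f g ∈ Set.Icc a b) {ε : ℝ} (hε : 0 < ε) :
    FinitelyColorable S (fun g h => |f g - f h| ≤ ε) :=
  of_totallyBounded (isCompact_Icc.totallyBounded.subset
    (by rintro _ ⟨g, hg, rfl⟩; exact hf g hg)) hε

theorem totallyBounded_image_of_finitelyColorable {ι α : Type*} [PseudoMetricSpace α] {S : Set ι}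
    {f : ι → α} (h : ∀ ε > 0, FinitelyColorable S (fun g h => dist (f g) (f h) < ε)) :
    TotallyBounded (f '' S) := by
  refine Metric.totallyBounded_iff.2 fun ε hε => ?_
  obtain ⟨t, ht, -, hcov⟩ := (h ε hε).exists_representative
  refine ⟨f '' t, ht.image f, ?_⟩
  rintro _ ⟨g, hg, rfl⟩
  obtain ⟨k, hk, hgk⟩ := hcov g hg
  exact Set.mem_iUnion₂.2 ⟨f k, ⟨k, hk, rfl⟩, hgk⟩

/-! ### Almost periodic functions along a strip, and the Kronecker algebra. -/

section Systems

variable {X : Type*} [MeasurableSpace X] [AddAction (ℤ × ℤ) X] [MeasurableConstVAdd (ℤ × ℤ) X]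

/-- The translates of `f` along `S` form a totally bounded family in `L¹(μ)`. -/
def AlmostPeriodic (μ : Measure X) (S : Set (ℤ × ℤ)) (f : X → ℝ) : Prop :=
  ∀ ε : ℝ≥0∞, 0 < ε →
    FinitelyColorable S (fun g h => eLpNorm (fun x => f (g +ᵥ x) - f (h +ᵥ x)) 1 μ ≤ ε)

theorem eLpNorm_one_indicator_vadd_sub (μ : Measure X) {B : Set X} (hB : MeasurableSet B)
    (g h : ℤ × ℤ) :
    eLpNorm (fun x => B.indicator (1 : X → ℝ) (g +ᵥ x) - B.indicator (1 : X → ℝ) (h +ᵥ x)) 1 μ =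
      μ (((fun x : X => g +ᵥ x) ⁻¹' B) ∆ ((fun x : X => h +ᵥ x) ⁻¹' B)) := by
  have := eLpNorm_indicator_sub_indicator (p := 1) (μ := μ) ((fun x : X => g +ᵥ x) ⁻¹' B)
    ((fun x : X => h +ᵥ x) ⁻¹' B) (fun _ => (1 : ℝ))
  rw [eLpNorm_indicator_const ((measurable_const_vadd g hB).symmDiff (measurable_const_vadd h hB))
    one_ne_zero ENNReal.one_ne_top] at this
  exact this.trans (by simp)

/-- A difference of indicators has modulus `0` or `1`, so the squared `L²` distance equals the `L¹`
distance. This links the `L²` definition to arguments carried out in `L¹`. -/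
theorem dist_koopman_indicatorConstLp (μ : Measure X) [IsProbabilityMeasure μ]
    [VAddInvariantMeasure (ℤ × ℤ) X μ] {B : Set X} (hB : MeasurableSet B) (g h : ℤ × ℤ) :
    dist (koopman μ g (indicatorConstLp 2 hB (measure_ne_top μ B) (1 : ℂ)))
      (koopman μ h (indicatorConstLp 2 hB (measure_ne_top μ B) (1 : ℂ))) =
      √(μ.real (((fun x : X => g +ᵥ x) ⁻¹' B) ∆ ((fun x : X => h +ᵥ x) ⁻¹' B))) := by
  have key : ∀ g : ℤ × ℤ, koopman μ g (indicatorConstLp 2 hB (measure_ne_top μ B) (1 : ℂ)) =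
      indicatorConstLp 2 (measurable_const_vadd g hB) (measure_ne_top μ _) (1 : ℂ) := fun g => rfl
  rw [key, key, dist_indicatorConstLp_eq_norm, norm_indicatorConstLp two_ne_zero ENNReal.ofNat_ne_top,
    Real.sqrt_eq_rpow]
  simp

/-- Membership in the Kronecker algebra is total boundedness of the orbit in `L¹`. -/
theorem mem_kroneckerAlgebra_iff (μ : Measure X) [IsProbabilityMeasure μ]
    [VAddInvariantMeasure (ℤ × ℤ) X μ] (β b : ℝ) {B : Set X} (hB : MeasurableSet B) :
    B ∈ kroneckerAlgebra μ β b ↔ AlmostPeriodic μ (strip β b) (B.indicator 1) := by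
  constructor
  · rintro ⟨hB, hc⟩ ε hε
    have htb := hc.totallyBounded.subset subset_closure
    -- An `L²` radius `δ` is an `L¹` radius `δ²`; `ε = ∞` needs its own choice.
    obtain ⟨δ, hδ, hδε⟩ : ∃ δ : ℝ, 0 < δ ∧ ENNReal.ofReal (δ ^ 2) ≤ ε := by
      rcases eq_or_ne ε ∞ with rfl | hε'
      · exact ⟨1, one_pos, le_top⟩
      · have := ENNReal.toReal_pos hε.ne' hε'
        exact ⟨√ε.toReal, by positivity, by rw [Real.sq_sqrt this.le, ENNReal.ofReal_toReal hε']⟩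
    refine (FinitelyColorable.of_totallyBounded htb hδ).mono fun g _ h _ hgh => ?_
    rw [dist_koopman_indicatorConstLp, Real.sqrt_le_left hδ.le] at hgh
    rw [eLpNorm_one_indicator_vadd_sub μ hB, ← ofReal_measureReal]
    exact (ENNReal.ofReal_le_ofReal hgh).trans hδε
  · intro h
    refine ⟨hB, (TotallyBounded.closure ?_).isCompact_of_isClosed isClosed_closure⟩
    refine totallyBounded_image_of_finitelyColorable fun ε hε => ?_
    refine (h (ENNReal.ofReal ((ε / 2) ^ 2)) (by positivity)).mono fun g _ k _ hgk => ?_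
    rw [eLpNorm_one_indicator_vadd_sub μ hB, ← ofReal_measureReal,
      ENNReal.ofReal_le_ofReal_iff (by positivity)] at hgk
    rw [dist_koopman_indicatorConstLp]
    exact (Real.sqrt_le_left (by positivity)).2 hgk |>.trans_lt (half_lt_self hε)

/-- Almost periodicity along a strip does not depend on the width of the strip. -/
theorem AlmostPeriodic.strip_change {μ : Measure X} [VAddInvariantMeasure (ℤ × ℤ) X μ]
    {f : X → ℝ} (hf : Measurable f) {β b : ℝ} (hb : 0 < b)
    (h : AlmostPeriodic μ (strip β b) f) (b' : ℝ) : AlmostPeriodic μ (strip β b') f := by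
  intro ε hε
  -- The offset `n - βm` is bounded on the wide strip. Elements whose offsets differ by at most `b /
  -- 2` have their difference in `strip β b`, so finitely many translates of that strip cover.
  obtain ⟨t, ht, htS, hcov⟩ := (FinitelyColorable.of_real_bounded (S := strip β b')
    (fun p : ℤ × ℤ => (p.2 : ℝ) - β * p.1) (a := -(b' / 2)) (b := b' / 2)
    (fun p hp => ⟨by linarith [hp.1], by linarith [hp.2]⟩) (half_pos hb)).exists_representative
  obtain ⟨n, c, hc⟩ := h ε hε
  have := ht.to_subtype
  have key : ∀ g, ∃ k : Option t, g ∈ strip β b' → ∃ k' : t, k = some k' ∧ g - k' ∈ strip β b := by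
    intro g
    by_cases hg : g ∈ strip β b'
    · obtain ⟨k, hk, hgk⟩ := hcov g hg
      refine ⟨some ⟨k, hk⟩, fun _ => ⟨⟨k, hk⟩, rfl, ?_⟩⟩
      rw [abs_le] at hgk
      simp only [strip, Set.mem_ofPred_eq, Prod.fst_sub, Prod.snd_sub, Int.cast_sub]
      constructor <;> linarith [hgk.1, hgk.2]
    · exact ⟨none, fun h => (hg h).elim⟩
  choose k hk using key
  -- The color of `g` records its translate `r` and the old color of `g - r`. For equal colors,
  -- composing with the measure-preserving map of `r` carries the estimate from `g - r` to `g`.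
  refine FinitelyColorable.of_finite
    (fun g => (k g, (k g).map fun r : t => c (g - r))) fun g hg g' hg' hgg' => ?_
  obtain ⟨r, hr, hgr⟩ := hk g hg
  obtain ⟨r', hr', hgr'⟩ := hk g' hg'
  simp only [hr, hr', Prod.mk.injEq, Option.some.injEq] at hgg'
  obtain ⟨rfl, hcc⟩ := hgg'
  have h1 := hc _ hgr _ hgr' (Option.some_injective _ hcc)
  beta_reduce at h1
  have h2 : ∀ g : ℤ × ℤ, Measurable fun x : X => f (g +ᵥ x) := fun g =>
    hf.comp (measurable_const_vadd g)
  have h3 := (eLpNorm_comp_measurePreserving (p := 1)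
    ((h2 (g - r)).sub (h2 (g' - r))).aestronglyMeasurable
    (measurePreserving_vadd (r : ℤ × ℤ) μ)).trans_le h1
  simpa [Function.comp_def, vadd_vadd] using h3

/-- Invariance of `μ` makes the approximation error the same at every point of the orbit, so a
three-term estimate suffices. -/
theorem AlmostPeriodic.of_approx {μ : Measure X} [VAddInvariantMeasure (ℤ × ℤ) X μ]
    {S : Set (ℤ × ℤ)} {f : X → ℝ} (hf : Measurable f)
    (h : ∀ ε : ℝ≥0∞, 0 < ε → ∃ f' : X → ℝ, Measurable f' ∧ AlmostPeriodic μ S f' ∧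
      eLpNorm (fun x => f x - f' x) 1 μ ≤ ε) : AlmostPeriodic μ S f := by
  intro ε hε
  obtain ⟨f', hf', hap, hd⟩ := h (ε / 3) (ENNReal.div_pos hε.ne' (by simp))
  refine (hap (ε / 3) (ENNReal.div_pos hε.ne' (by simp))).mono fun g _ k _ hgk => ?_
  have h2 : ∀ g : ℤ × ℤ, eLpNorm (fun x : X => f (g +ᵥ x) - f' (g +ᵥ x)) 1 μ ≤ ε / 3 := fun g =>
    (eLpNorm_comp_measurePreserving (hf.sub hf').aestronglyMeasurable
      (measurePreserving_vadd g μ)).trans_le hd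
  have m : ∀ g : ℤ × ℤ, Measurable fun x : X => f (g +ᵥ x) := fun g =>
    hf.comp (measurable_const_vadd g)
  have m' : ∀ g : ℤ × ℤ, Measurable fun x : X => f' (g +ᵥ x) := fun g =>
    hf'.comp (measurable_const_vadd g)
  have e : (fun x : X => f (g +ᵥ x) - f (k +ᵥ x)) =
      ((fun x => f (g +ᵥ x) - f' (g +ᵥ x)) + (fun x => f' (g +ᵥ x) - f' (k +ᵥ x)))
        - (fun x => f (k +ᵥ x) - f' (k +ᵥ x)) := by
    ext x
    simp
  rw [e]
  refine (eLpNorm_sub_le (((m g).sub (m' g)).add ((m' g).sub (m' k))).aestronglyMeasurable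
    ((m k).sub (m' k)).aestronglyMeasurable le_rfl).trans ?_
  refine (add_le_add_left (eLpNorm_add_le ((m g).sub (m' g)).aestronglyMeasurable
    ((m' g).sub (m' k)).aestronglyMeasurable le_rfl) _).trans ?_
  calc _ ≤ ε / 3 + ε / 3 + ε / 3 := add_le_add (add_le_add (h2 g) hgk) (h2 k)
    _ = ε := ENNReal.add_thirds ε

omit [MeasurableConstVAdd (ℤ × ℤ) X] in
theorem AlmostPeriodic.lipschitz_comp {μ : Measure X} {S : Set (ℤ × ℤ)} {f : X → ℝ}
    (h : AlmostPeriodic μ S f) {K : NNReal} {φ : ℝ → ℝ} (hφ : LipschitzWith K φ) :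
    AlmostPeriodic μ S (fun x => φ (f x)) := by
  intro ε hε
  -- `K + 1` rather than `K` keeps the divisor nonzero.
  refine (h (ε / (K + 1)) (ENNReal.div_pos hε.ne' (by finiteness))).mono fun g _ k _ hgk => ?_
  calc eLpNorm (fun x => φ (f (g +ᵥ x)) - φ (f (k +ᵥ x))) 1 μ
      ≤ K • eLpNorm (fun x => f (g +ᵥ x) - f (k +ᵥ x)) 1 μ := by
        refine eLpNorm_le_nnreal_smul_eLpNorm_of_ae_le_mul (Filter.Eventually.of_forall fun x => ?_) 1
        have := hφ.nndist_le (f (g +ᵥ x)) (f (k +ᵥ x))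
        simpa [nndist_eq_nnnorm] using this
    _ ≤ (K + 1) * (ε / (K + 1)) := by
        rw [ENNReal.smul_def, smul_eq_mul]
        exact mul_le_mul' le_self_add hgk
    _ ≤ ε := ENNReal.mul_div_le

/-- Superlevel sets of almost periodic functions are almost periodic. -/
theorem AlmostPeriodic.indicator_superlevel {μ : Measure X} [IsProbabilityMeasure μ]
    [VAddInvariantMeasure (ℤ × ℤ) X μ] {S : Set (ℤ × ℤ)} {f : X → ℝ} (hf : Measurable f)
    (h : AlmostPeriodic μ S f) (a : ℝ) :
    AlmostPeriodic μ S ({x | a < f x}.indicator 1) := by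
  have hm : MeasurableSet {x | a < f x} := measurableSet_lt measurable_const hf
  have hM : Measurable ({x | a < f x}.indicator (1 : X → ℝ)) := measurable_one.indicator hm
  -- Lipschitz ramps, zero up to `a`, which converge pointwise to the indicator of the open
  -- half-line above `a`; domination by `1` gives convergence in `L¹`.
  let φ : ℕ → ℝ → ℝ := fun n y => min 1 (max 0 (n * (y - a)))
  have hφc : ∀ n, Continuous (φ n) := fun n => by fun_prop
  have hφ : ∀ n : ℕ, LipschitzWith (n : NNReal) (φ n) := fun n => by
    refine LipschitzWith.const_min (LipschitzWith.const_max ?_ 0) 1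
    refine LipschitzWith.of_dist_le_mul fun y z => ?_
    simp [Real.dist_eq, ← mul_sub, abs_mul]
  have hlim : Filter.Tendsto (fun n => eLpNorm
      (fun x => {x | a < f x}.indicator (1 : X → ℝ) x - φ n (f x)) 1 μ) Filter.atTop (nhds 0) := by
    simp_rw [eLpNorm_one_eq_lintegral_enorm]
    rw [← lintegral_zero (μ := μ)]
    refine tendsto_lintegral_of_dominated_convergence (fun _ => 1)
      (fun n => (hM.sub ((hφc n).measurable.comp hf)).enorm) (fun n => ?_) (by simp) ?_
    · refine Filter.Eventually.of_forall fun x => ?_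
      beta_reduce
      rw [← ofReal_norm, ← ENNReal.ofReal_one]
      refine ENNReal.ofReal_le_ofReal ?_
      have h0 : 0 ≤ φ n (f x) := le_min zero_le_one (le_max_left _ _)
      have h1 : φ n (f x) ≤ 1 := min_le_left _ _
      rw [Real.norm_eq_abs, abs_le]
      by_cases hx : x ∈ {x | a < f x} <;> simp only [hx, Set.indicator_of_mem,
        Set.indicator_of_notMem, not_false_eq_true, Pi.one_apply] <;> constructor <;> linarith
    · refine Filter.Eventually.of_forall fun x => ?_
      refine tendsto_const_nhds.congr' ?_
      by_cases hx : a < f x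
      · obtain ⟨N, hN⟩ := exists_nat_gt (1 / (f x - a))
        filter_upwards [Filter.eventually_ge_atTop N] with n hn
        have hp : 0 < f x - a := sub_pos.2 hx
        have : 1 ≤ (n : ℝ) * (f x - a) := by
          rw [← div_le_iff₀ hp]
          exact hN.le.trans (by exact_mod_cast hn)
        simp [φ, hx, min_eq_left this]
      · refine Filter.Eventually.of_forall fun n => ?_
        have : (n : ℝ) * (f x - a) ≤ 0 :=
          mul_nonpos_of_nonneg_of_nonpos n.cast_nonneg (by linarith)
        simp [φ, hx, max_eq_left this]
  refine AlmostPeriodic.of_approx hM fun ε hε => ?_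
  obtain ⟨n, hn⟩ := (hlim.eventually (eventually_le_nhds hε)).exists
  exact ⟨fun x => φ n (f x), (hφc n).measurable.comp hf, h.lipschitz_comp (hφ n), hn⟩

/-- In a weakly mixing system, almost periodic functions are almost everywhere constant. -/
theorem IsWeakMixing.ae_const_of_almostPeriodic {μ : Measure X} [IsProbabilityMeasure μ]
    [VAddInvariantMeasure (ℤ × ℤ) X μ] {β b b' : ℝ} (hb' : 0 < b')
    (hμ : IsWeakMixing μ β b) {f : X → ℝ} (hf : Measurable f)
    (h : AlmostPeriodic μ (strip β b') f) : ∃ a, ∀ᵐ x ∂μ, f x = a := by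
  -- Countably many open half-lines separate points of `ℝ`, so it is enough that each superlevel set
  -- is null or conull.
  have : HasCountableSeparatingOn ℝ (· ∈ Set.range Set.Ioi) Set.univ :=
    HasCountableSeparatingOn.range_Ioi
  refine Filter.exists_eventuallyEq_const_of_forall_separating (· ∈ Set.range Set.Ioi) ?_
  rintro _ ⟨a, rfl⟩
  have hm : MeasurableSet {x | a < f x} := measurableSet_lt measurable_const hf
  -- The width of the given strip is traded here for the width in the mixing hypothesis.
  have := (h.strip_change hf hb' b).indicator_superlevel hf a
  rcases hμ _ ((mem_kroneckerAlgebra_iff μ β b hm).2 this) with h0 | h1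
  · right
    filter_upwards [h0] with x hx hax
    have : x ∈ (∅ : Set X) := hx.mp hax
    exact this
  · left
    filter_upwards [h1] with x hx
    exact hx.mpr trivial

end Systems

/-! ### Fiber measures and compactness of integral operators with indicator kernels. -/

section Fiber

variable {X Y : Type*} [MeasurableSpace X] [MeasurableSpace Y]

/-- The measure of the part of the fiber of `E` over `x` that lies in `W`. -/
noncomputable def fiberMass (ν : Measure Y) (E : Set (X × Y)) (W : Set Y) (x : X) : ℝ :=
  ν.real (Prod.mk x ⁻¹' E ∩ W)

theorem measurable_fiberMass (ν : Measure Y) [IsProbabilityMeasure ν] {E : Set (X × Y)}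
    (hE : MeasurableSet E) {W : Set Y} (hW : MeasurableSet W) : Measurable (fiberMass ν E W) := by
  have : fiberMass ν E W = fun x => (ν (Prod.mk x ⁻¹' (E ∩ Prod.snd ⁻¹' W))).toReal := rfl
  rw [this]
  exact (measurable_measure_prodMk_left (hE.inter (measurable_snd hW))).ennreal_toReal

omit [MeasurableSpace X] in
theorem fiberMass_compl (ν : Measure Y) [IsProbabilityMeasure ν] {E : Set (X × Y)} {x : X}
    (hE : MeasurableSet (Prod.mk x ⁻¹' E)) (W : Set Y) :
    fiberMass ν Eᶜ W x = ν.real W - fiberMass ν E W x := by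
  have := measureReal_inter_add_sdiff (μ := ν) (s := W) hE
  simp only [fiberMass, Set.preimage_compl]
  rw [Set.inter_comm _ W, Set.inter_comm _ W, ← Set.sdiff_eq]
  linarith

omit [MeasurableSpace X] in
theorem fiberMass_union (ν : Measure Y) [IsProbabilityMeasure ν] {E F : Set (X × Y)} {x : X}
    (hEF : Disjoint E F) (hF : MeasurableSet (Prod.mk x ⁻¹' F)) {W : Set Y}
    (hW : MeasurableSet W) :
    fiberMass ν (E ∪ F) W x = fiberMass ν E W x + fiberMass ν F W x := by
  simp only [fiberMass, Set.preimage_union, Set.union_inter_distrib_right]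
  refine measureReal_union ?_ (hF.inter hW)
  exact (hEF.preimage _).mono Set.inter_subset_left Set.inter_subset_left

/-- A function dominated by the measure of the fibers of `D` has `L¹` norm at most that of `D`. -/
theorem eLpNorm_one_le_measure_prod (μ : Measure X) (ν : Measure Y)
    [IsProbabilityMeasure μ] [IsProbabilityMeasure ν] {D : Set (X × Y)} (hD : MeasurableSet D)
    {f : X → ℝ} (hf : ∀ x, |f x| ≤ ν.real (Prod.mk x ⁻¹' D)) :
    eLpNorm f 1 μ ≤ μ.prod ν D := by
  rw [eLpNorm_one_eq_lintegral_enorm, Measure.prod_apply hD]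
  refine lintegral_mono fun x => ?_
  rw [← ofReal_norm, ← ofReal_measureReal]
  exact ENNReal.ofReal_le_ofReal (hf x)

theorem abs_measureReal_sub_le {ν : Measure Y} [IsProbabilityMeasure ν] {A B D : Set Y}
    (hAB : A ⊆ B ∪ D) (hBA : B ⊆ A ∪ D) : |ν.real A - ν.real B| ≤ ν.real D := by
  have h1 := (measureReal_mono (μ := ν) hAB).trans (measureReal_union_le B D)
  have h2 := (measureReal_mono (μ := ν) hBA).trans (measureReal_union_le A D)
  rw [abs_le]
  constructor <;> linarith

/-- The compactness of the integral operator with kernel `1_E`: the functions `x ↦ ν (E_x ∩ W)`,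
for `W` in any family of measurable sets, are totally bounded in `L¹`. -/
theorem finitelyColorable_fiberMass (μ : Measure X) (ν : Measure Y)
    [IsProbabilityMeasure μ] [IsProbabilityMeasure ν] {ι : Type*} (S : Set ι) {W : ι → Set Y}
    (hW : ∀ g, MeasurableSet (W g)) {E : Set (X × Y)} (hE : MeasurableSet E) :
    ∀ ε : ℝ≥0∞, 0 < ε → FinitelyColorable S
      (fun g h => eLpNorm (fiberMass ν E (W g) - fiberMass ν E (W h)) 1 μ ≤ ε) := by
  have real_case : ∀ C : Set Y, ∀ ε : ℝ≥0∞, 0 < ε →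
      FinitelyColorable S (fun g h => ENNReal.ofReal |ν.real (C ∩ W g) - ν.real (C ∩ W h)| ≤ ε) := by
    intro C ε hε
    obtain ⟨δ, hδ, hδε⟩ : ∃ δ : ℝ, 0 < δ ∧ ENNReal.ofReal δ ≤ ε := by
      rcases eq_or_ne ε ∞ with rfl | hε'
      · exact ⟨1, one_pos, le_top⟩
      · exact ⟨ε.toReal, ENNReal.toReal_pos hε.ne' hε', ENNReal.ofReal_toReal_le⟩
    refine (FinitelyColorable.of_real_bounded (fun g => ν.real (C ∩ W g)) (a := 0) (b := 1)
      (fun g _ => ⟨measureReal_nonneg, measureReal_le_one⟩) hδ).mono fun g _ h _ hgh => ?_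
    exact (ENNReal.ofReal_le_ofReal hgh).trans hδε
  have fm : ∀ {E : Set (X × Y)}, MeasurableSet E → ∀ x, MeasurableSet (Prod.mk x ⁻¹' E) :=
    fun hE x => measurable_prodMk_left hE
  have meas : ∀ {E : Set (X × Y)}, MeasurableSet E → ∀ g h, AEStronglyMeasurable
      (fiberMass ν E (W g) - fiberMass ν E (W h)) μ := fun hE g h =>
    ((measurable_fiberMass ν hE (hW g)).sub (measurable_fiberMass ν hE (hW h))).aestronglyMeasurable
  -- For a rectangle `A ×ˢ C` the function is `1_A(x) ν(C ∩ W)`, of rank one, so `real_case` settles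
  -- it. The property then passes to complements and countable disjoint unions, which reaches every
  -- measurable `E`.
  induction E, hE using MeasurableSpace.induction_on_inter generateFrom_prod.symm isPiSystem_prod with
  | empty =>
    intro ε hε
    exact ⟨1, fun _ => 0, fun g _ h _ _ => by
      have : ∀ W : Set Y, fiberMass ν (∅ : Set (X × Y)) W = 0 := fun W => by
        ext x
        simp [fiberMass]
      simp [this]⟩
  | basic t ht =>
    obtain ⟨A, -, C, -, rfl⟩ := ht
    intro ε hε
    refine (real_case C ε hε).mono fun g _ h _ hgh => ?_
    rw [eLpNorm_one_eq_lintegral_enorm]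
    calc ∫⁻ x, ‖(fiberMass ν (A ×ˢ C) (W g) - fiberMass ν (A ×ˢ C) (W h)) x‖ₑ ∂μ
        ≤ ∫⁻ _, ε ∂μ := by
          refine lintegral_mono fun x => le_trans ?_ hgh
          by_cases hx : x ∈ A
          · simp [fiberMass, hx, Set.mk_preimage_prod_right, ← ofReal_norm]
          · simp [fiberMass, hx, Set.mk_preimage_prod_right_eq_empty]
      _ = ε := by simp
  | compl t ht ih =>
    intro ε hε
    have hε2 : 0 < ε / 2 := ENNReal.half_pos hε.ne'
    refine ((real_case Set.univ (ε / 2) hε2).and (ih (ε / 2) hε2)).mono fun g _ h _ hgh => ?_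
    simp only [Set.univ_inter] at hgh
    have e : fiberMass ν tᶜ (W g) - fiberMass ν tᶜ (W h) =
        (fun _ => ν.real (W g) - ν.real (W h)) - (fiberMass ν t (W g) - fiberMass ν t (W h)) := by
      ext x
      simp only [Pi.sub_apply, fiberMass_compl ν (fm ht x)]
      ring
    rw [e]
    refine (eLpNorm_sub_le aestronglyMeasurable_const (meas ht g h) le_rfl).trans ?_
    calc _ ≤ ε / 2 + ε / 2 := add_le_add (by
            rw [eLpNorm_one_eq_lintegral_enorm]
            simpa [← ofReal_norm] using hgh.1) hgh.2
      _ = ε := ENNReal.add_halves ε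
  | iUnion f hdisj hf ih =>
    have hU : ∀ n, MeasurableSet (⋃ i ∈ Finset.range n, f i) := fun n =>
      Finset.measurableSet_biUnion _ fun i _ => hf i
    have partial_case : ∀ n : ℕ, ∀ ε : ℝ≥0∞, 0 < ε → FinitelyColorable S (fun g h =>
        eLpNorm (fiberMass ν (⋃ i ∈ Finset.range n, f i) (W g) -
          fiberMass ν (⋃ i ∈ Finset.range n, f i) (W h)) 1 μ ≤ ε) := by
      intro n
      induction n with
      | zero =>
        intro ε hε
        exact ⟨1, fun _ => 0, fun g _ h _ _ => by
          have : ∀ W : Set Y, fiberMass ν (∅ : Set (X × Y)) W = 0 := fun W => by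
            ext x
            simp [fiberMass]
          simp [this]⟩
      | succ n ihn =>
        intro ε hε
        have hε2 : 0 < ε / 2 := ENNReal.half_pos hε.ne'
        refine ((ihn (ε / 2) hε2).and (ih n (ε / 2) hε2)).mono fun g _ h _ hgh => ?_
        have hd : Disjoint (⋃ i ∈ Finset.range n, f i) (f n) := by
          simp only [Set.disjoint_iUnion_left]
          exact fun i hi => hdisj (Finset.mem_range.1 hi).ne
        have e0 : (⋃ i ∈ Finset.range (n + 1), f i) = (⋃ i ∈ Finset.range n, f i) ∪ f n := by
          rw [Finset.range_add_one, Finset.set_biUnion_insert, Set.union_comm]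
        have e : fiberMass ν (⋃ i ∈ Finset.range (n + 1), f i) (W g) -
            fiberMass ν (⋃ i ∈ Finset.range (n + 1), f i) (W h) =
            (fiberMass ν (⋃ i ∈ Finset.range n, f i) (W g) -
              fiberMass ν (⋃ i ∈ Finset.range n, f i) (W h)) +
            (fiberMass ν (f n) (W g) - fiberMass ν (f n) (W h)) := by
          ext x
          simp only [e0, Pi.sub_apply, Pi.add_apply, fiberMass_union ν hd (fm (hf n) x) (hW _)]
          ring
        rw [e]
        refine (eLpNorm_add_le (meas (hU n) g h) (meas (hf n) g h) le_rfl).trans ?_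
        exact (add_le_add hgh.1 hgh.2).trans (ENNReal.add_halves ε).le
    intro ε hε
    have hε3 : 0 < ε / 3 := ENNReal.div_pos hε.ne' (by simp)
    have hE : MeasurableSet (⋃ i, f i) := MeasurableSet.iUnion hf
    -- The measure of the tail bounds the `L¹` error of truncation uniformly in `W`, so one `n`
    -- serves all indices.
    have hlim : Filter.Tendsto (fun n => μ.prod ν ((⋃ i, f i) \ ⋃ i ∈ Finset.range n, f i))
        Filter.atTop (nhds 0) := by
      have := tendsto_measure_iInter_atTop (μ := μ.prod ν)
        (s := fun n => (⋃ i, f i) \ ⋃ i ∈ Finset.range n, f i)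
        (fun n => (hE.diff (hU n)).nullMeasurableSet)
        (fun m n hmn => Set.sdiff_subset_sdiff_right
          (Set.biUnion_subset_biUnion_left (Finset.coe_subset.2 (Finset.range_mono hmn))))
        ⟨0, measure_ne_top _ _⟩
      rwa [← Set.sdiff_iUnion, Set.sdiff_eq_empty.2, measure_empty] at this
      exact Set.iUnion_subset fun i => Set.subset_iUnion_of_subset (i + 1)
        (Set.subset_biUnion_of_mem (u := f) (by simp))
    obtain ⟨n, hn⟩ := (hlim.eventually (eventually_le_nhds hε3)).exists
    refine (partial_case n (ε / 3) hε3).mono fun g _ h _ hgh => ?_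
    set P := ⋃ i ∈ Finset.range n, f i
    have hPE : P ⊆ ⋃ i, f i := Set.iUnion₂_subset fun i _ => Set.subset_iUnion f i
    have app : ∀ g, eLpNorm (fiberMass ν (⋃ i, f i) (W g) - fiberMass ν P (W g)) 1 μ ≤ ε / 3 := by
      refine fun g => (eLpNorm_one_le_measure_prod μ ν (hE.diff (hU n)) fun x => ?_).trans hn
      refine abs_measureReal_sub_le ?_ ?_
      · rintro y ⟨hy, hyW⟩
        by_cases hyP : (x, y) ∈ P
        · exact Or.inl ⟨hyP, hyW⟩
        · exact Or.inr ⟨hy, hyP⟩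
      · rintro y ⟨hy, hyW⟩
        exact Or.inl ⟨hPE hy, hyW⟩
    have app_meas : ∀ g, AEStronglyMeasurable
        (fiberMass ν (⋃ i, f i) (W g) - fiberMass ν P (W g)) μ := fun g =>
      ((measurable_fiberMass ν hE (hW g)).sub
        (measurable_fiberMass ν (hU n) (hW g))).aestronglyMeasurable
    have e : fiberMass ν (⋃ i, f i) (W g) - fiberMass ν (⋃ i, f i) (W h) =
        ((fiberMass ν (⋃ i, f i) (W g) - fiberMass ν P (W g)) +
          (fiberMass ν P (W g) - fiberMass ν P (W h))) -
        (fiberMass ν (⋃ i, f i) (W h) - fiberMass ν P (W h)) := by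
      abel
    rw [e]
    refine (eLpNorm_sub_le ((app_meas g).add (meas (hU n) g h)) (app_meas h) le_rfl).trans ?_
    refine (add_le_add_left (eLpNorm_add_le (app_meas g) (meas (hU n) g h) le_rfl) _).trans ?_
    exact (add_le_add (add_le_add (app g) hgh) (app h)).trans (ENNReal.add_thirds ε).le

end Fiber

/-! ### Independence of almost periodic sets from both factors. -/

section Product

variable {X Y : Type*} [MeasurableSpace X] [AddAction (ℤ × ℤ) X] [MeasurableConstVAdd (ℤ × ℤ) X]
  [MeasurableSpace Y] [AddAction (ℤ × ℤ) Y] [MeasurableConstVAdd (ℤ × ℤ) Y]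

omit [MeasurableConstVAdd (ℤ × ℤ) X] in
theorem fiberMass_vadd (ν : Measure Y) [VAddInvariantMeasure (ℤ × ℤ) Y ν] {B : Set (X × Y)}
    (hB : MeasurableSet B) {C : Set Y} (hC : MeasurableSet C) (g : ℤ × ℤ) (x : X) :
    fiberMass ν B C (g +ᵥ x) = fiberMass ν ((fun z : X × Y => g +ᵥ z) ⁻¹' B)
      ((fun y : Y => g +ᵥ y) ⁻¹' C) x := by
  simp only [fiberMass, measureReal_def]
  rw [← (measurePreserving_vadd g ν).measure_preimage
    ((measurable_prodMk_left hB).inter hC).nullMeasurableSet]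
  rfl

/-- Integrating an almost periodic set of the product over a set in the second factor gives an
almost periodic function on the first factor. -/
theorem AlmostPeriodic.fiberMass {μ : Measure X} {ν : Measure Y} [IsProbabilityMeasure μ]
    [IsProbabilityMeasure ν] [VAddInvariantMeasure (ℤ × ℤ) Y ν]
    {S : Set (ℤ × ℤ)} {B : Set (X × Y)} (hB : MeasurableSet B)
    (h : AlmostPeriodic (μ.prod ν) S (B.indicator 1)) {C : Set Y} (hC : MeasurableSet C) :
    AlmostPeriodic μ S (fiberMass ν B C) := by
  intro ε hε
  have hε3 : 0 < ε / 3 := ENNReal.div_pos hε.ne' (by simp)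
  let W : ℤ × ℤ → Set Y := fun g => (fun y : Y => g +ᵥ y) ⁻¹' C
  let T : ℤ × ℤ → Set (X × Y) := fun g => (fun z : X × Y => g +ᵥ z) ⁻¹' B
  have hW : ∀ g, MeasurableSet (W g) := fun g => measurable_const_vadd g hC
  have hT : ∀ g, MeasurableSet (T g) := fun g => measurable_const_vadd g hB
  obtain ⟨t, ht, -, hcov⟩ := (h (ε / 3) hε3).exists_representative
  have := ht.to_subtype
  have hrep : FinitelyColorable S (fun g h => ∃ k : t,
      μ.prod ν (T g ∆ T k) ≤ ε / 3 ∧ μ.prod ν (T h ∆ T k) ≤ ε / 3) := by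
    refine FinitelyColorable.of_representative (t := Set.univ)
      (q := fun g (k : t) => μ.prod ν (T g ∆ T k) ≤ ε / 3) Set.finite_univ (fun g hg => ?_)
      fun g _ h _ k hg hh => ⟨k, hg, hh⟩
    obtain ⟨k, hk, hgk⟩ := hcov g hg
    rw [eLpNorm_one_indicator_vadd_sub _ hB] at hgk
    exact ⟨⟨k, hk⟩, trivial, hgk⟩
  -- Two colorings are combined: one replaces `T g` by a nearby `T k`, the other controls the
  -- dependence on `W g` for all the finitely many kernels `T k` at once.
  refine (hrep.and (FinitelyColorable.forall_finite fun k : t =>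
    finitelyColorable_fiberMass μ ν S hW (hT k) (ε / 3) hε3)).mono fun g _ h _ hgh => ?_
  obtain ⟨⟨k, hgk, hhk⟩, hall⟩ := hgh
  have app : ∀ g, μ.prod ν (T g ∆ T k) ≤ ε / 3 →
      eLpNorm (DirectionalMixing.fiberMass ν (T g) (W g) -
        DirectionalMixing.fiberMass ν (T k) (W g)) 1 μ ≤ ε / 3 := by
    refine fun g hg => (eLpNorm_one_le_measure_prod μ ν ((hT g).symmDiff (hT k))
      fun x => abs_measureReal_sub_le ?_ ?_).trans hg
    · rintro y ⟨hy, hyW⟩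
      by_cases hyk : (x, y) ∈ T k
      · exact Or.inl ⟨hyk, hyW⟩
      · exact Or.inr (Or.inl ⟨hy, hyk⟩)
    · rintro y ⟨hy, hyW⟩
      by_cases hyg : (x, y) ∈ T g
      · exact Or.inl ⟨hyg, hyW⟩
      · exact Or.inr (Or.inr ⟨hy, hyg⟩)
  have meas : ∀ g g' h h', AEStronglyMeasurable
      (DirectionalMixing.fiberMass ν (T g) (W g') - DirectionalMixing.fiberMass ν (T h) (W h')) μ :=
    fun g g' h h' => ((measurable_fiberMass ν (hT g) (hW g')).sub
      (measurable_fiberMass ν (hT h) (hW h'))).aestronglyMeasurable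
  have e : (fun x => DirectionalMixing.fiberMass ν B C (g +ᵥ x) -
        DirectionalMixing.fiberMass ν B C (h +ᵥ x)) =
      ((DirectionalMixing.fiberMass ν (T g) (W g) - DirectionalMixing.fiberMass ν (T k) (W g)) +
        (DirectionalMixing.fiberMass ν (T k) (W g) - DirectionalMixing.fiberMass ν (T k) (W h))) -
      (DirectionalMixing.fiberMass ν (T h) (W h) - DirectionalMixing.fiberMass ν (T k) (W h)) := by
    ext x
    simp only [fiberMass_vadd ν hB hC, Pi.add_apply, Pi.sub_apply]
    ring
  rw [e]
  refine (eLpNorm_sub_le ((meas g g k g).add (meas k g k h)) (meas h h k h) le_rfl).trans ?_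
  refine (add_le_add_left (eLpNorm_add_le (meas g g k g) (meas k g k h) le_rfl) _).trans ?_
  exact (add_le_add (add_le_add (app g hgk) (hall k)) (app h hhk)).trans (ENNReal.add_thirds ε).le

/-- An almost periodic set of the product is independent of the first factor if that factor is
weakly mixing. -/
theorem IsWeakMixing.prod_inter_prod {μ : Measure X} {ν : Measure Y} [IsProbabilityMeasure μ]
    [IsProbabilityMeasure ν] [VAddInvariantMeasure (ℤ × ℤ) X μ] [VAddInvariantMeasure (ℤ × ℤ) Y ν]
    {β b b' : ℝ} (hb' : 0 < b') (hμ : IsWeakMixing μ β b) {B : Set (X × Y)} (hB : MeasurableSet B)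
    (h : AlmostPeriodic (μ.prod ν) (strip β b') (B.indicator 1)) {A : Set X} (hA : MeasurableSet A)
    {C : Set Y} (hC : MeasurableSet C) :
    μ.prod ν (B ∩ A ×ˢ C) = μ A * μ.prod ν (B ∩ Set.univ ×ˢ C) := by
  obtain ⟨a, ha⟩ := hμ.ae_const_of_almostPeriodic hb' (measurable_fiberMass ν hB hC)
    (h.fiberMass hB hC)
  have ha' : ∀ᵐ x ∂μ, ν (Prod.mk x ⁻¹' B ∩ C) = ENNReal.ofReal a := by
    filter_upwards [ha] with x hx
    rw [← hx, DirectionalMixing.fiberMass, ofReal_measureReal]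
  have key : ∀ A : Set X, MeasurableSet A →
      μ.prod ν (B ∩ A ×ˢ C) = ENNReal.ofReal a * μ A := by
    intro A hA
    rw [Measure.prod_apply (hB.inter (hA.prod hC)), ← setLIntegral_const,
      ← lintegral_indicator hA]
    refine lintegral_congr_ae ?_
    filter_upwards [ha'] with x hx
    by_cases hxA : x ∈ A
    · simp [hxA, Set.mk_preimage_prod_right, hx]
    · simp [hxA, Set.mk_preimage_prod_right_eq_empty]
  rw [key A hA, key _ MeasurableSet.univ, measure_univ, mul_one, mul_comm]

theorem AlmostPeriodic.swap {μ : Measure X} {ν : Measure Y} [IsProbabilityMeasure μ]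
    [IsProbabilityMeasure ν] {S : Set (ℤ × ℤ)} {B : Set (X × Y)} (hB : MeasurableSet B)
    (h : AlmostPeriodic (μ.prod ν) S (B.indicator 1)) :
    AlmostPeriodic (ν.prod μ) S ((Prod.swap ⁻¹' B).indicator 1) := by
  intro ε hε
  refine (h ε hε).mono fun g _ k _ hgk => ?_
  rw [eLpNorm_one_indicator_vadd_sub _ hB] at hgk
  rw [eLpNorm_one_indicator_vadd_sub _ (measurable_swap hB)]
  rw [← Measure.measurePreserving_swap.measure_preimage
    ((measurable_const_vadd g hB).symmDiff (measurable_const_vadd k hB)).nullMeasurableSet] at hgk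
  exact hgk

/-- The product of two weakly mixing systems is weakly mixing, whatever the widths of the strips. -/
theorem IsWeakMixing.prod {μ : Measure X} {ν : Measure Y} [IsProbabilityMeasure μ]
    [IsProbabilityMeasure ν] [VAddInvariantMeasure (ℤ × ℤ) X μ] [VAddInvariantMeasure (ℤ × ℤ) Y ν]
    {β b₁ b₂ b : ℝ} (hb : 0 < b) (hμ : IsWeakMixing μ β b₁) (hν : IsWeakMixing ν β b₂) :
    IsWeakMixing (μ.prod ν) β b := by
  intro B hB
  have hBm : MeasurableSet B := hB.1
  have hap := (mem_kroneckerAlgebra_iff (μ.prod ν) β b hBm).1 hB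
  have hsw : ∀ E : Set (X × Y), MeasurableSet E → ν.prod μ (Prod.swap ⁻¹' E) = μ.prod ν E :=
    fun E hE => Measure.measurePreserving_swap.measure_preimage hE.nullMeasurableSet
  have hrect : ∀ (A : Set X) (C : Set Y), MeasurableSet A → MeasurableSet C →
      μ.prod ν (A ×ˢ C ∩ B) = μ.prod ν B * (μ A * ν C) := by
    intro A C hA hC
    -- Independence from the second factor, obtained in the swapped product with the whole of `X` as
    -- the other side.
    have h2 := hν.prod_inter_prod hb (measurable_swap hBm) (hap.swap hBm) hC MeasurableSet.univ
    have e : ∀ C : Set Y, Prod.swap ⁻¹' B ∩ C ×ˢ (Set.univ : Set X) =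
        Prod.swap ⁻¹' (B ∩ Set.univ ×ˢ C) := fun C => by
      rw [Set.preimage_inter, Set.preimage_swap_prod]
    rw [e, e, hsw _ (hBm.inter (MeasurableSet.univ.prod hC)),
      hsw _ (hBm.inter (MeasurableSet.univ.prod MeasurableSet.univ)), Set.univ_prod_univ,
      Set.inter_univ] at h2
    rw [Set.inter_comm, hμ.prod_inter_prod hb hBm hap hA hC, h2]
    ring
  have := Measure.smul_finite μ (measure_ne_top (μ.prod ν) B)
  -- Rectangles determine a finite product measure, so restricting to `B` only scales it. The scalar
  -- sits on `μ` to keep the product form; evaluating at `B` then gives `m = m²`.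
  have hmeas : (μ.prod ν).restrict B = (μ.prod ν B • μ).prod ν := by
    refine (Measure.prod_eq fun A C hA hC => ?_).symm
    rw [Measure.restrict_apply (hA.prod hC), hrect A C hA hC, Measure.smul_apply, smul_eq_mul,
      mul_assoc]
  have hsq : μ.prod ν B = μ.prod ν B * μ.prod ν B := by
    have := congrArg (fun m => m B) hmeas
    simpa [Measure.prod_smul_left] using this
  rcases eq_or_ne (μ.prod ν B) 0 with h0 | h0
  · exact Or.inl (ae_eq_empty.2 h0)
  · right
    have h1 : μ.prod ν B = 1 :=
      ((ENNReal.mul_eq_left h0 (measure_ne_top _ _)).1 hsq.symm)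
    rw [ae_eq_univ, prob_compl_eq_zero_iff hBm, h1]

end Product

end DirectionalMixing

theorem mainTheorem7
    {X₁ : Type*} [MetricSpace X₁] [CompactSpace X₁] [MeasurableSpace X₁] [BorelSpace X₁]
    [AddAction (ℤ × ℤ) X₁] [ContinuousConstVAdd (ℤ × ℤ) X₁]
    {X₂ : Type*} [MetricSpace X₂] [CompactSpace X₂] [MeasurableSpace X₂] [BorelSpace X₂]
    [AddAction (ℤ × ℤ) X₂] [ContinuousConstVAdd (ℤ × ℤ) X₂]
    (μ : MeasureTheory.Measure X₁) [MeasureTheory.IsProbabilityMeasure μ]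
    [MeasureTheory.VAddInvariantMeasure (ℤ × ℤ) X₁ μ]
    (ν : MeasureTheory.Measure X₂) [MeasureTheory.IsProbabilityMeasure ν]
    [MeasureTheory.VAddInvariantMeasure (ℤ × ℤ) X₂ ν]
    (β b₁ b₂ b : ℝ) (hb₁ : 0 < b₁) (hb₂ : 0 < b₂) (hb : 0 < b)
    (hμ : DirectionalMixing.IsWeakMixing μ β b₁) (hν : DirectionalMixing.IsWeakMixing ν β b₂) :
    DirectionalMixing.IsWeakMixing (μ.prod ν) β b := by
  exact hμ.prod hb hν
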